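/- Let $M$ be a smooth, paracompact, Hausdorff, connected, finite-dimensional manifold without boundary. A \emph{proper cone structure} $(M,C)$ assigns to each $p\in M$ a nonempty convex cone $C_p\subseteq T_pM\setminus\{0\}$ (a convex set, stable under multiplication by positive reals) which is closed in $T_pM\setminus\{0\}$ and sharp ($C_p\cup\{0\}$ contains no line through the origin), such that the cone bundle $C=\bigcup_p C_p$ is closed in the slit tangent bundle $TM\setminus(TM)_0$ ($TM$ minus the zero section) and $(\operatorname{int} C)_p=(\operatorname{int} C)\cap T_pM\neq\emptyset$ for all $p\in M$, where the interior is taken in $TM$. A \emph{future directed causal curve} is an absolutely continuous curve $\gamma\colon[a,b]\to M$, $a<b$, with $\dot\gamma(t)\in C_{\gamma(t)}$ for almost every $t$; it is \emph{past directed causal} if instead $-\dot\gamma(t)\in C_{\gamma(t)}$ for almost every $t$. Write $p\le q$ if $p=q$ or there is a future directed causal curve from $p$ to $q$, and $p<q$ if $p\le q$ and $p\ne q$. A \emph{time function} is a continuous $\tau\colon M\to\mathbb R$ such that $p<q$ implies $\tau(p)<\tau(q)$. It is \emph{locally anti-Lipschitz} if every point of $M$ has a neighborhood $U$ and a Riemannian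 metric $h$ on $M$, with Riemannian distance $d_h$, such that \[ p,q\in U \text{ and } p\le q \;\Longrightarrow\; \tau(q)-\tau(p)\ge d_h(p,q). \] A path $\beta\colon[a_0,a_k]\to M$ is \emph{piecewise causal} if for some partition $a_0<a_1<\dots<a_k$, $k\ge1$, each restriction $\beta|_{[a_{i-1},a_i]}$ is a future directed or a past directed causal curve. Its \emph{null length} is $\hat L_\tau(\beta)=\sum_{i=1}^k|\tau(\beta(a_i))-\tau(\beta(a_{i-1}))|$. The \emph{null distance} is \[ \hat d_\tau(p,q)=\inf\{\hat L_\tau(\beta)\,;\,\beta \text{ a piecewise causal path from } p \text{ to } q\}\in[0,\infty],\qquad \inf\emptyset=\infty . \] \textbf{Theorem.} Let $(M,C)$ be a proper cone structure with a locally anti-Lipschitz time function $\tau\colon M\to\mathbb R$. Then the null distance $\hat d_\tau$ is a metric on $M$ (in particular it takes only finite values) that induces the manifold topology. -/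

import Mathlib

open Set MeasureTheory Topology
open scoped Manifold ContDiff ENNReal Bundle

namespace ConeGeometry

noncomputable section

/-! ### Cones in a vector space -/

/-- A convex cone: a convex subset of `V \ {0}` that is stable under
multiplication by positive reals. -/
structure IsConvexCone {V : Type*} [AddCommGroup V] [Module ℝ V] (K : Set V) : Prop where
  zero_notMem : (0 : V) ∉ K
  smul_mem : ∀ v ∈ K, ∀ s : ℝ, 0 < s → s • v ∈ K
  convex : Convex ℝ K

/-- A cone `K` is sharp if `K ∪ {0}` contains no line through the origin. -/
def IsSharpCone {V : Type*} [AddCommGroup V] [Module ℝ V] (K : Set V) : Prop :=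
  ¬ ∃ v : V, v ≠ 0 ∧ ∀ s : ℝ, s • v ∈ insert (0 : V) K

/-- A cone is closed if it is closed in the topology induced on `V \ {0}`. -/
def IsClosedCone {V : Type*} [AddCommGroup V] [TopologicalSpace V] (K : Set V) : Prop :=
  IsClosed ((fun v : {v : V // v ≠ 0} => (v : V)) ⁻¹' K)

section Manifold

variable {E : Type*} [NormedAddCommGroup E] [NormedSpace ℝ E]
  {M : Type*} [TopologicalSpace M] [ChartedSpace E M]

/-! ### Cone structures -/

/-- The total space `{(p, v) | v ∈ C_p}` of a family of cones, as a subset of `TM`. -/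
def coneBundle (C : (p : M) → Set (TangentSpace 𝓘(ℝ, E) p)) : Set (TangentBundle 𝓘(ℝ, E) M) :=
  {x | x.2 ∈ C x.1}

/-- A cone structure: every `C_p ⊆ T_pM \ {0}` is a nonempty closed sharp convex cone. -/
def IsConeStructure (C : (p : M) → Set (TangentSpace 𝓘(ℝ, E) p)) : Prop :=
  ∀ p : M, IsConvexCone (C p) ∧ IsSharpCone (C p) ∧ IsClosedCone (C p) ∧ (C p).Nonempty

/-- A closed cone structure: the cone bundle is closed in the slit tangent bundle
`TM \ {zero section}`. -/
def IsClosedConeStructure [IsManifold 𝓘(ℝ, E) ∞ M]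
    (C : (p : M) → Set (TangentSpace 𝓘(ℝ, E) p)) : Prop :=
  IsConeStructure C ∧
    IsClosed ((fun x : {x : TangentBundle 𝓘(ℝ, E) M // x.2 ≠ 0} =>
      (x : TangentBundle 𝓘(ℝ, E) M)) ⁻¹' coneBundle C)

/-- `(int C)_p`: the fibre over `p` of the interior of the cone bundle.  The interior is taken in
`TM`; since the slit tangent bundle is open in `TM`, it is the same as the interior there. -/
def timelikeCone [IsManifold 𝓘(ℝ, E) ∞ M]
    (C : (p : M) → Set (TangentSpace 𝓘(ℝ, E) p)) (p : M) : Set (TangentSpace 𝓘(ℝ, E) p) :=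
  {v | (⟨p, v⟩ : TangentBundle 𝓘(ℝ, E) M) ∈ interior (coneBundle C)}

/-- A proper cone structure: a closed cone structure with `(int C)_p ≠ ∅` for all `p`. -/
def IsProperConeStructure [IsManifold 𝓘(ℝ, E) ∞ M]
    (C : (p : M) → Set (TangentSpace 𝓘(ℝ, E) p)) : Prop :=
  IsClosedConeStructure C ∧ ∀ p : M, (timelikeCone C p).Nonempty

/-! ### Causal curves, the causal relation, time functions -/

/-- `γ` is absolutely continuous on `[a, b]`: it is continuous there, and its coordinate
expression is absolutely continuous on every compact subinterval that `γ` maps into the domain of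
a chart. -/
def IsACPath (E : Type*) [NormedAddCommGroup E] [NormedSpace ℝ E]
    {M : Type*} [TopologicalSpace M] [ChartedSpace E M] (γ : ℝ → M) (a b : ℝ) : Prop :=
  ContinuousOn γ (Icc a b) ∧
    ∀ e ∈ atlas E M, ∀ c d : ℝ, a ≤ c → c ≤ d → d ≤ b → MapsTo γ (Icc c d) e.source →
      AbsolutelyContinuousOnInterval (e ∘ γ) c d

/-- `γ` restricted to `[a, b]` is an absolutely continuous solution of the differential inclusion
`γ'(t) ∈ D_{γ(t)}` (for almost every `t`), where `a < b`. -/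
def SolvesInclusion (D : (p : M) → Set (TangentSpace 𝓘(ℝ, E) p)) (γ : ℝ → M) (a b : ℝ) : Prop :=
  a < b ∧ IsACPath E γ a b ∧
    ∀ᵐ t ∂(volume.restrict (Icc a b)),
      MDifferentiableAt 𝓘(ℝ, ℝ) 𝓘(ℝ, E) γ t ∧ mfderiv 𝓘(ℝ, ℝ) 𝓘(ℝ, E) γ t (1 : ℝ) ∈ D (γ t)

/-- `γ` restricted to `[a, b]` is a future directed causal curve. -/
def IsFutureCausal (C : (p : M) → Set (TangentSpace 𝓘(ℝ, E) p)) (γ : ℝ → M) (a b : ℝ) : Prop :=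
  SolvesInclusion C γ a b

/-- `γ` restricted to `[a, b]` is a past directed causal curve: the negative of its velocity is
future directed. -/
def IsPastCausal (C : (p : M) → Set (TangentSpace 𝓘(ℝ, E) p)) (γ : ℝ → M) (a b : ℝ) : Prop :=
  SolvesInclusion (fun p => {v : TangentSpace 𝓘(ℝ, E) p | -v ∈ C p}) γ a b

/-- The causal relation `p ≤ q`. -/
def CausalRel (C : (p : M) → Set (TangentSpace 𝓘(ℝ, E) p)) (p q : M) : Prop :=
  p = q ∨ ∃ (γ : ℝ → M) (a b : ℝ), IsFutureCausal C γ a b ∧ γ a = p ∧ γ b = q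

/-- Time functions: continuous, and strictly increasing along the causal relation. -/
def IsTimeFunction (C : (p : M) → Set (TangentSpace 𝓘(ℝ, E) p)) (τ : M → ℝ) : Prop :=
  Continuous τ ∧ ∀ p q : M, CausalRel C p q → p ≠ q → τ p < τ q

/-- The distance `d_h` of a smooth Riemannian metric `h` on `M`: the infimum of the `h`-lengths of
`C^1` paths. -/
def riemDist [IsManifold 𝓘(ℝ, E) ∞ M]
    (h : Bundle.ContMDiffRiemannianMetric 𝓘(ℝ, E) ∞ E
      (fun p : M => TangentSpace 𝓘(ℝ, E) p)) (p q : M) : ℝ≥0∞ :=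
  letI : Bundle.RiemannianBundle (fun p : M => TangentSpace 𝓘(ℝ, E) p) := ⟨h.toRiemannianMetric⟩
  Manifold.riemannianEDist 𝓘(ℝ, E) p q

/-- `τ` is locally anti-Lipschitz: every point has a neighbourhood `U` and a Riemannian metric `h`
with `d_h(p, q) ≤ τ(q) - τ(p)` whenever `p, q ∈ U` and `p ≤ q`. -/
def IsLocallyAntiLipschitz [IsManifold 𝓘(ℝ, E) ∞ M]
    (C : (p : M) → Set (TangentSpace 𝓘(ℝ, E) p)) (τ : M → ℝ) : Prop :=
  ∀ x : M, ∃ U ∈ 𝓝 x, ∃ h : Bundle.ContMDiffRiemannianMetric 𝓘(ℝ, E) ∞ E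
      (fun p : M => TangentSpace 𝓘(ℝ, E) p),
    ∀ p ∈ U, ∀ q ∈ U, CausalRel C p q → riemDist h p q ≤ ENNReal.ofReal (τ q - τ p)

/-! ### The null distance -/

/-- `β` on `[a 0, a k]` is piecewise causal with respect to the partition
`a 0 < a 1 < ⋯ < a k`, `k ≥ 1`: on each `[a i, a (i+1)]` it is a future directed or a past directed
causal curve.  (Only the values `a 0, …, a k` of `a` matter.) -/
def IsPiecewiseCausal (C : (p : M) → Set (TangentSpace 𝓘(ℝ, E) p)) (β : ℝ → M)
    (k : ℕ) (a : ℕ → ℝ) : Prop :=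
  0 < k ∧ ∀ i < k, IsFutureCausal C β (a i) (a (i + 1)) ∨ IsPastCausal C β (a i) (a (i + 1))

/-- The null length of a piecewise causal path. -/
def nullLength (τ : M → ℝ) (β : ℝ → M) (k : ℕ) (a : ℕ → ℝ) : ℝ :=
  ∑ i ∈ Finset.range k, |τ (β (a (i + 1))) - τ (β (a i))|

/-- The null distance: the infimum of the null lengths of the piecewise causal paths from `p` to
`q`, with values in `[0, ∞]` (it is `∞` if there is no such path). -/
def nullDist (C : (p : M) → Set (TangentSpace 𝓘(ℝ, E) p)) (τ : M → ℝ) (p q : M) : ℝ≥0∞ :=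
  ⨅ (β : ℝ → M) (k : ℕ) (a : ℕ → ℝ) (_ : IsPiecewiseCausal C β k a)
    (_ : β (a 0) = p) (_ : β (a k) = q), ENNReal.ofReal (nullLength τ β k a)

end Manifold

end

end ConeGeometry

/-!
The null distance `d̂` is symmetric and satisfies the triangle inequality because piecewise causal
paths can be reversed and concatenated (`nullDist_comm`, `nullDist_triangle`). The two remaining
points are comparisons with the manifold topology.

*Upper bound.* In a chart at `x`, a vector in the interior of the cone bundle gives a vector `w₀`
such that every vector close to `w₀` is future causal at every point close to `x`. So there is a
point `r`, as close to `x` as one wishes, to which straight future causal segments lead from all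
points `y` close to `x` (`exists_eventually_isFutureCausal`). Along a causal curve the null length
is the difference of the values of `τ`, hence `d̂ x y ≤ |τ r - τ x| + |τ r - τ y|`, which is small
by continuity of `τ` (`eventually_nullDist_lt`). With `y = x` this gives `d̂ x x = 0`, and on a
connected manifold it shows that `d̂` is finite, since the points at finite distance from a given
one form a clopen set (`nullDist_ne_top`).

*Lower bound.* Let `B` be an open neighbourhood of `p` whose closure lies in a set on which
`τ q - τ p ≥ d_h p q` for causally related points. A piecewise causal path that starts at `p` has
null length at least the `d_h`-distance between its endpoints as long as its break points stay in
`B`; if a break point lies outside `B`, the path has crossed the frontier of `B`, and its null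
length up to the crossing is already at least the `d_h`-distance from `p` to the complement of `B`
(`riemDist_le_nullLength_or`). That distance is positive because `d_h` induces the manifold
topology. So `d̂ p` is bounded below by a positive constant outside each neighbourhood of `p`
(`exists_le_nullDist`).
-/

namespace ConeGeometry

/-! ### Absolutely continuous functions and affine reparametrizations -/

theorem _root_.AbsolutelyContinuousOnInterval.congr {X : Type*} [PseudoMetricSpace X]
    {f g : ℝ → X} {a b : ℝ} (hf : AbsolutelyContinuousOnInterval f a b)
    (h : EqOn f g (uIcc a b)) : AbsolutelyContinuousOnInterval g a b := by
  rw [absolutelyContinuousOnInterval_iff] at hf ⊢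
  intro ε hε
  obtain ⟨δ, hδ, H⟩ := hf ε hε
  refine ⟨δ, hδ, fun I hI hlt => ?_⟩
  convert H I hI hlt using 1
  refine Finset.sum_congr rfl fun i hi => ?_
  rw [h (hI.1 i hi).1, h (hI.1 i hi).2]

theorem _root_.AbsolutelyContinuousOnInterval.comp_add_const {X : Type*} [PseudoMetricSpace X]
    {f : ℝ → X} {a b : ℝ} (c : ℝ) (hf : AbsolutelyContinuousOnInterval f (a + c) (b + c)) :
    AbsolutelyContinuousOnInterval (fun t => f (t + c)) a b := by
  rw [absolutelyContinuousOnInterval_iff] at hf ⊢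
  intro ε hε
  obtain ⟨δ, hδ, H⟩ := hf ε hε
  refine ⟨δ, hδ, fun I hI hlt => ?_⟩
  refine H (I.1, fun i => ((I.2 i).1 + c, (I.2 i).2 + c)) ⟨fun i hi => ?_, fun i hi j hj hij => ?_⟩
    (by simpa using hlt)
  · have := hI.1 i hi
    simp only [mem_uIcc] at this ⊢
    grind
  · have := hI.2 hi hj hij
    simp only [Function.onFun, uIoc, Ioc_disjoint_Ioc] at this ⊢
    grind

theorem _root_.AbsolutelyContinuousOnInterval.comp_neg {X : Type*} [PseudoMetricSpace X]
    {f : ℝ → X} {a b : ℝ} (hf : AbsolutelyContinuousOnInterval f (-a) (-b)) :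
    AbsolutelyContinuousOnInterval (fun t => f (-t)) a b := by
  rw [absolutelyContinuousOnInterval_iff] at hf ⊢
  intro ε hε
  obtain ⟨δ, hδ, H⟩ := hf ε hε
  refine ⟨δ, hδ, fun I hI hlt => ?_⟩
  refine H (I.1, fun i => (-(I.2 i).1, -(I.2 i).2)) ⟨fun i hi => ?_, fun i hi j hj hij => ?_⟩
    (by simpa using hlt)
  · have := hI.1 i hi
    simp only [mem_uIcc] at this ⊢
    grind
  · -- Reflection exchanges the two kinds of half-open intervals; disjointness is a condition on
    -- the endpoints only, so it is preserved.
    have := hI.2 hi hj hij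
    simp only [Function.onFun, uIoc, Ioc_disjoint_Ioc] at this ⊢
    grind

section Curves

variable {E : Type*} [NormedAddCommGroup E] [NormedSpace ℝ E]
  {M : Type*} [TopologicalSpace M] [ChartedSpace E M]
  {C D : (p : M) → Set (TangentSpace 𝓘(ℝ, E) p)} {γ γ' : ℝ → M} {a b c d : ℝ}

/-! ### Operations on causal curves -/

theorem IsACPath.congr (h : IsACPath E γ a b) (hγ : EqOn γ γ' (Icc a b)) :
    IsACPath E γ' a b := by
  refine ⟨h.1.congr hγ.symm, fun e he c d hac hcd hdb hm => ?_⟩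
  have hs : Icc c d ⊆ Icc a b := Icc_subset_Icc hac hdb
  refine (h.2 e he c d hac hcd hdb fun t ht => ?_).congr fun t ht => ?_
  · rw [hγ (hs ht)]
    exact hm ht
  · rw [uIcc_of_le hcd] at ht
    simp [hγ (hs ht)]

theorem SolvesInclusion.congr (h : SolvesInclusion D γ a b) (hγ : EqOn γ γ' (Icc a b)) :
    SolvesInclusion D γ' a b := by
  refine ⟨h.1, h.2.1.congr hγ, ?_⟩
  have h3 := h.2.2
  -- On the open interval the curves agree near each point, hence have the same derivative.
  rw [← restrict_Ioo_eq_restrict_Icc] at h3 ⊢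
  filter_upwards [h3, ae_restrict_mem measurableSet_Ioo] with t ht hmem
  have hev : γ' =ᶠ[𝓝 t] γ := by
    filter_upwards [Ioo_mem_nhds hmem.1 hmem.2] with s hs
    exact (hγ (Ioo_subset_Icc_self hs)).symm
  refine ⟨ht.1.congr_of_eventuallyEq hev, ?_⟩
  -- All tangent spaces are definitionally `E`, so a vector can be moved along an equality of points.
  have key : ∀ (p q : M) (v : E), p = q → v ∈ (D p : Set E) → v ∈ (D q : Set E) := by
    rintro p q v rfl hv
    exact hv
  have hd := hev.mfderiv_eq (I := 𝓘(ℝ, ℝ)) (I' := 𝓘(ℝ, E))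
  rw [hd]
  exact key _ _ _ hev.eq_of_nhds.symm ht.2

theorem SolvesInclusion.mono (h : SolvesInclusion D γ a b) (hac : a ≤ c) (hcd : c < d)
    (hdb : d ≤ b) : SolvesInclusion D γ c d :=
  ⟨hcd, ⟨h.2.1.1.mono (Icc_subset_Icc hac hdb), fun e he c' d' h1 h2 h3 =>
    h.2.1.2 e he c' d' (hac.trans h1) h2 (h3.trans hdb)⟩,
    ae_restrict_of_ae_restrict_of_subset (Icc_subset_Icc hac hdb) h.2.2⟩

theorem SolvesInclusion.comp_add_const (c : ℝ) (h : SolvesInclusion D γ (a + c) (b + c)) :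
    SolvesInclusion D (fun t => γ (t + c)) a b := by
  have hmaps : ∀ x y : ℝ, MapsTo (fun t => t + c) (Icc x y) (Icc (x + c) (y + c)) :=
    fun x y t ht => ⟨by linarith [ht.1], by linarith [ht.2]⟩
  refine ⟨by linarith [h.1], ⟨h.2.1.1.comp (by fun_prop) (hmaps a b),
    fun e he x y hx hxy hy hm => ?_⟩, ?_⟩
  · refine AbsolutelyContinuousOnInterval.comp_add_const c (f := e ∘ γ)
      (h.2.1.2 e he _ _ (by linarith) (by linarith) (by linarith) fun t ht => ?_)
    simpa using @hm (t - c) ⟨by linarith [ht.1], by linarith [ht.2]⟩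
  · have h3 := h.2.2
    rw [ae_restrict_iff' measurableSet_Icc] at h3 ⊢
    filter_upwards [(measurePreserving_add_right volume c).quasiMeasurePreserving.ae h3]
      with t ht hmem
    obtain ⟨h4, h5⟩ := ht (hmaps a b hmem)
    have hσ : HasMFDerivAt 𝓘(ℝ, ℝ) 𝓘(ℝ, ℝ) (fun t : ℝ => t + c) t
        (ContinuousLinearMap.id ℝ ℝ) :=
      ((hasFDerivAt_id t).add_const c).hasMFDerivAt
    have hc := h4.hasMFDerivAt.comp t hσ
    refine ⟨hc.mdifferentiableAt, ?_⟩
    have := hc.mfderiv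
    change mfderiv 𝓘(ℝ, ℝ) 𝓘(ℝ, E) (γ ∘ fun t => t + c) t (1 : ℝ) ∈ D (γ (t + c))
    rw [this]
    exact h5

theorem SolvesInclusion.comp_neg (h : SolvesInclusion D γ (-b) (-a)) :
    SolvesInclusion (fun p => {v : TangentSpace 𝓘(ℝ, E) p | -v ∈ D p}) (fun t => γ (-t)) a b := by
  have hmaps : ∀ x y : ℝ, MapsTo (fun t => -t) (Icc x y) (Icc (-y) (-x)) :=
    fun x y t ht => ⟨by linarith [ht.2], by linarith [ht.1]⟩
  refine ⟨by linarith [h.1], ⟨h.2.1.1.comp (by fun_prop) (hmaps a b),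
    fun e he x y hx hxy hy hm => ?_⟩, ?_⟩
  · refine AbsolutelyContinuousOnInterval.comp_neg (f := e ∘ γ)
      (h.2.1.2 e he _ _ (by linarith) (by linarith) (by linarith) fun t ht => ?_).symm
    simpa using @hm (-t) ⟨by linarith [ht.2], by linarith [ht.1]⟩
  · have h3 := h.2.2
    rw [ae_restrict_iff' measurableSet_Icc] at h3 ⊢
    filter_upwards [(Measure.measurePreserving_neg (volume : Measure ℝ)).quasiMeasurePreserving.ae
      h3] with t ht hmem
    obtain ⟨h4, h5⟩ := ht (hmaps a b hmem)
    have hσ : HasMFDerivAt 𝓘(ℝ, ℝ) 𝓘(ℝ, ℝ) (fun t : ℝ => -t) t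
        (-ContinuousLinearMap.id ℝ ℝ) :=
      (hasFDerivAt_id t).neg.hasMFDerivAt
    have hc := h4.hasMFDerivAt.comp t hσ
    refine ⟨hc.mdifferentiableAt, ?_⟩
    have := hc.mfderiv
    change -(mfderiv 𝓘(ℝ, ℝ) 𝓘(ℝ, E) (γ ∘ fun t => -t) t (1 : ℝ)) ∈ D (γ (-t))
    rw [this]
    have h6 : -(((mfderiv 𝓘(ℝ, ℝ) 𝓘(ℝ, E) γ (-t)).comp (-ContinuousLinearMap.id ℝ ℝ)) (1 : ℝ) : E)
        = mfderiv 𝓘(ℝ, ℝ) 𝓘(ℝ, E) γ (-t) (1 : ℝ) := by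
      change -((mfderiv 𝓘(ℝ, ℝ) 𝓘(ℝ, E) γ (-t)) (-(1 : ℝ)) : E) = _
      have h7 := (mfderiv 𝓘(ℝ, ℝ) 𝓘(ℝ, E) γ (-t)).map_neg (1 : ℝ)
      exact (congrArg (fun v : E => -v) h7).trans (neg_neg (G := E) _)
    exact h6 ▸ h5

theorem IsFutureCausal.comp_neg (h : IsFutureCausal C γ (-b) (-a)) :
    IsPastCausal C (fun t => γ (-t)) a b :=
  SolvesInclusion.comp_neg h

theorem IsPastCausal.comp_neg (h : IsPastCausal C γ (-b) (-a)) :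
    IsFutureCausal C (fun t => γ (-t)) a b := by
  have := SolvesInclusion.comp_neg h
  simp only [mem_ofPred_eq, neg_neg, ofPred_mem_eq] at this
  exact this

theorem IsFutureCausal.causalRel (h : IsFutureCausal C γ a b) (hac : a ≤ c) (hcd : c ≤ d)
    (hdb : d ≤ b) : CausalRel C (γ c) (γ d) := by
  rcases hcd.eq_or_lt with rfl | hlt
  · exact Or.inl rfl
  · exact Or.inr ⟨γ, c, d, SolvesInclusion.mono h hac hlt hdb, rfl, rfl⟩

theorem IsPastCausal.causalRel (h : IsPastCausal C γ a b) (hac : a ≤ c) (hcd : c ≤ d)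
    (hdb : d ≤ b) : CausalRel C (γ d) (γ c) := by
  have h' : IsFutureCausal C (fun t => γ (-t)) (-b) (-a) :=
    IsPastCausal.comp_neg (by simpa using h)
  simpa using h'.causalRel (c := -d) (d := -c) (by linarith) (by linarith) (by linarith)

theorem IsTimeFunction.le {τ : M → ℝ} (hτ : IsTimeFunction C τ) {p q : M}
    (h : CausalRel C p q) : τ p ≤ τ q := by
  by_cases hpq : p = q
  · rw [hpq]
  · exact (hτ.2 p q h hpq).le

theorem IsTimeFunction.abs_sub_le_of_causal {τ : M → ℝ} (hτ : IsTimeFunction C τ)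
    {β : ℝ → M} {a b t : ℝ}
    (hβ : IsFutureCausal C β a b ∨ IsPastCausal C β a b) (ht : t ∈ Icc a b) :
    |τ (β t) - τ (β a)| ≤ |τ (β b) - τ (β a)| := by
  rcases hβ with hβ | hβ
  · have h1 := hτ.le (hβ.causalRel le_rfl ht.1 ht.2)
    have h2 := hτ.le (hβ.causalRel ht.1 ht.2 le_rfl)
    rw [abs_of_nonneg (by linarith), abs_of_nonneg (by linarith)]
    linarith
  · have h1 := hτ.le (hβ.causalRel le_rfl ht.1 ht.2)
    have h2 := hτ.le (hβ.causalRel ht.1 ht.2 le_rfl)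
    rw [abs_of_nonpos (by linarith), abs_of_nonpos (by linarith)]
    linarith

end Curves

section NullDist

/-! ### Symmetry and the triangle inequality for the null distance -/

theorem nullLength_nonneg {M : Type*} (τ : M → ℝ) (β : ℝ → M) (k : ℕ) (a : ℕ → ℝ) :
    0 ≤ nullLength τ β k a :=
  Finset.sum_nonneg fun _ _ => abs_nonneg _

variable {E : Type*} [NormedAddCommGroup E] [NormedSpace ℝ E]
  {M : Type*} [TopologicalSpace M] [ChartedSpace E M]
  {C : (p : M) → Set (TangentSpace 𝓘(ℝ, E) p)} {τ : M → ℝ}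

theorem nullDist_le {β : ℝ → M} {k : ℕ} {a : ℕ → ℝ} (h : IsPiecewiseCausal C β k a) :
    nullDist C τ (β (a 0)) (β (a k)) ≤ ENNReal.ofReal (nullLength τ β k a) :=
  iInf_le_of_le β <| iInf_le_of_le k <| iInf_le_of_le a <| iInf_le_of_le h <|
    iInf_le_of_le rfl <| iInf_le _ rfl

theorem IsPiecewiseCausal.lt {β : ℝ → M} {k : ℕ} {a : ℕ → ℝ} (h : IsPiecewiseCausal C β k a)
    {i : ℕ} (hi : i < k) : a i < a (i + 1) :=
  (h.2 i hi).elim (fun h => h.1) fun h => h.1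

theorem IsPiecewiseCausal.mono {β : ℝ → M} {k : ℕ} {a : ℕ → ℝ} (h : IsPiecewiseCausal C β k a)
    {i j : ℕ} (hij : i ≤ j) (hj : j ≤ k) : a i ≤ a j := by
  induction j, hij using Nat.le_induction with
  | base => rfl
  | succ j _ ih => exact (ih (by omega)).trans (h.lt (by omega)).le

/-- Reversing the time parameter turns a piecewise causal path from `p` to `q` into one from `q`
to `p` of the same null length. -/
theorem nullDist_le_swap (p q : M) : nullDist C τ p q ≤ nullDist C τ q p := by
  refine le_iInf fun β => le_iInf fun k => le_iInf fun a => le_iInf fun h => le_iInf fun hp =>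
    le_iInf fun hq => ?_
  have h' : IsPiecewiseCausal C (fun t => β (-t)) k (fun i => -a (k - i)) := by
    refine ⟨h.1, fun i hi => ?_⟩
    have e : k - i = k - (i + 1) + 1 := by omega
    rcases h.2 (k - (i + 1)) (by omega) with h1 | h1 <;> rw [← e] at h1
    · exact Or.inr (IsFutureCausal.comp_neg (by simpa using h1))
    · exact Or.inl (IsPastCausal.comp_neg (by simpa using h1))
  have hl : nullLength τ (fun t => β (-t)) k (fun i => -a (k - i)) = nullLength τ β k a := by
    simp only [nullLength, neg_neg]
    rw [← Finset.sum_range_reflect (fun i => |τ (β (a (i + 1))) - τ (β (a i))|)]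
    refine Finset.sum_congr rfl fun i hi => ?_
    have hi := Finset.mem_range.1 hi
    rw [abs_sub_comm, show k - (i + 1) = k - 1 - i by omega, show k - i = k - 1 - i + 1 by omega]
  have := nullDist_le (τ := τ) h'
  simpa [hl, hp, hq] using this

theorem nullDist_comm (p q : M) : nullDist C τ p q = nullDist C τ q p :=
  (nullDist_le_swap p q).antisymm (nullDist_le_swap q p)

/-- Two piecewise causal paths, the second one starting where the first one ends, can be
concatenated after a translation of the parameter of the second one. -/
theorem exists_isPiecewiseCausal_concat {β₁ β₂ : ℝ → M} {k₁ k₂ : ℕ} {a₁ a₂ : ℕ → ℝ}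
    (h₁ : IsPiecewiseCausal C β₁ k₁ a₁) (h₂ : IsPiecewiseCausal C β₂ k₂ a₂)
    (h : β₁ (a₁ k₁) = β₂ (a₂ 0)) :
    ∃ (β : ℝ → M) (k : ℕ) (a : ℕ → ℝ), IsPiecewiseCausal C β k a ∧ β (a 0) = β₁ (a₁ 0) ∧
      β (a k) = β₂ (a₂ k₂) ∧
      nullLength τ β k a = nullLength τ β₁ k₁ a₁ + nullLength τ β₂ k₂ a₂ := by
  set c := a₂ 0 - a₁ k₁ with hc
  set β : ℝ → M := fun t => if t ≤ a₁ k₁ then β₁ t else β₂ (t + c) with hβ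
  set a : ℕ → ℝ := fun i => if i ≤ k₁ then a₁ i else a₂ (i - k₁) - c with ha
  have e₁ : ∀ t ≤ a₁ k₁, β₁ t = β t := fun t ht => by simp [hβ, ht]
  have e₂ : ∀ t, a₁ k₁ ≤ t → β₂ (t + c) = β t := fun t ht => by
    rcases ht.eq_or_lt with rfl | hlt
    · simp [hβ, hc, h]
    · simp [hβ, hlt]
  have f₁ : ∀ i ≤ k₁, a i = a₁ i := fun i hi => by simp [ha, hi]
  have f₂ : ∀ j, a (k₁ + j) = a₂ j - c := fun j => by
    rcases j with _ | j
    · simp [ha, hc]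
    · simp [ha]
  have g₁ : ∀ i ≤ k₁, β (a i) = β₁ (a₁ i) := fun i hi => by
    rw [f₁ i hi, e₁ _ (h₁.mono hi le_rfl)]
  have g₂ : ∀ j ≤ k₂, β (a (k₁ + j)) = β₂ (a₂ j) := fun j hj => by
    rw [f₂ j, ← e₂ _ (by linarith [h₂.mono (Nat.zero_le _) hj]), sub_add_cancel]
  refine ⟨β, k₁ + k₂, a, ⟨by have := h₁.1; omega, fun i hi => ?_⟩, g₁ 0 (by omega),
    g₂ k₂ le_rfl, ?_⟩
  · rcases lt_or_ge i k₁ with hik | hik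
    · have hE : EqOn β₁ β (Icc (a₁ i) (a₁ (i + 1))) := fun t ht =>
        e₁ t (ht.2.trans (h₁.mono hik le_rfl))
      rw [f₁ i hik.le, f₁ (i + 1) hik]
      exact (h₁.2 i hik).imp (fun h => SolvesInclusion.congr h hE)
        fun h => SolvesInclusion.congr h hE
    · obtain ⟨j, rfl⟩ := Nat.exists_eq_add_of_le hik
      have hj : j < k₂ := by omega
      have hE : EqOn (fun t => β₂ (t + c)) β (Icc (a₂ j - c) (a₂ (j + 1) - c)) := fun t ht =>
        e₂ t (by linarith [ht.1, h₂.mono (Nat.zero_le _) hj.le])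
      rw [add_assoc, f₂ j, f₂ (j + 1)]
      refine (h₂.2 j hj).imp (fun h => SolvesInclusion.congr ?_ hE)
        fun h => SolvesInclusion.congr ?_ hE <;>
      exact SolvesInclusion.comp_add_const c (by simp only [sub_add_cancel]; exact h)
  · rw [nullLength, Finset.sum_range_add]
    congr 1 <;> refine Finset.sum_congr rfl fun i hi => ?_ <;> have hi := Finset.mem_range.1 hi
    · rw [g₁ i hi.le, g₁ (i + 1) hi]
    · rw [add_assoc, g₂ i hi.le, g₂ (i + 1) hi]

theorem nullDist_triangle (p q r : M) :
    nullDist C τ p r ≤ nullDist C τ p q + nullDist C τ q r := by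
  conv_rhs => simp only [nullDist, ENNReal.iInf_add]
  refine le_iInf fun β₁ => le_iInf fun k₁ => le_iInf fun a₁ => le_iInf fun h₁ => le_iInf fun hp =>
    le_iInf fun hq => ?_
  simp only [nullDist, ENNReal.add_iInf]
  refine le_iInf fun β₂ => le_iInf fun k₂ => le_iInf fun a₂ => le_iInf fun h₂ =>
    le_iInf fun hq' => le_iInf fun hr => ?_
  obtain ⟨β, k, a, h, h0, hk, hl⟩ :=
    exists_isPiecewiseCausal_concat (τ := τ) h₁ h₂ (hq.trans hq'.symm)
  rw [← ENNReal.ofReal_add (nullLength_nonneg ..) (nullLength_nonneg ..), ← hl]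
  have := nullDist_le (τ := τ) h
  rw [h0, hk, hp, hr] at this
  simpa only [nullDist] using this

theorem IsFutureCausal.nullDist_le {γ : ℝ → M} {a b : ℝ} (h : IsFutureCausal C γ a b) :
    nullDist C τ (γ a) (γ b) ≤ ENNReal.ofReal |τ (γ b) - τ (γ a)| := by
  have h' : IsPiecewiseCausal C γ 1 (fun i => if i = 0 then a else b) :=
    ⟨one_pos, fun i hi => by
      obtain rfl : i = 0 := by omega
      exact Or.inl (by simpa using h)⟩
  simpa [nullLength] using ConeGeometry.nullDist_le (τ := τ) h'

end NullDist

section Local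

variable {E : Type*} [NormedAddCommGroup E] [NormedSpace ℝ E]
  {M : Type*} [TopologicalSpace M] [ChartedSpace E M] [IsManifold 𝓘(ℝ, E) ∞ M]
  {C : (p : M) → Set (TangentSpace 𝓘(ℝ, E) p)} {τ : M → ℝ}

/-! ### Timelike segments in charts -/

/-- The image under an inverse chart of a segment all of whose velocities are mapped into the
cones is a future directed causal curve. -/
theorem isFutureCausal_chart_symm_segment {x : M} {z w : E} {s : ℝ} (hs : 0 < s)
    (h : ∀ t ∈ Icc 0 s, z + t • w ∈ (chartAt E x).target ∧
      mfderiv 𝓘(ℝ, E) 𝓘(ℝ, E) (chartAt E x).symm (z + t • w) w ∈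
        C ((chartAt E x).symm (z + t • w))) :
    IsFutureCausal C (fun t => (chartAt E x).symm (z + t • w)) 0 s := by
  have hline : ContDiff ℝ ∞ (fun t : ℝ => z + t • w) := by fun_prop
  have hγ : ContMDiffOn 𝓘(ℝ, ℝ) 𝓘(ℝ, E) ∞ (fun t => (chartAt E x).symm (z + t • w)) (Icc 0 s) :=
    (contMDiffOn_chart_symm (I := 𝓘(ℝ, E)) (n := ∞) (x := x)).comp
      hline.contMDiff.contMDiffOn fun t ht => (h t ht).1
  refine ⟨hs, ⟨hγ.continuousOn, fun e he c d hc hcd hd hm => ?_⟩, ?_⟩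
  · refine ContDiffOn.absolutelyContinuousOnInterval ?_
    rw [uIcc_of_le hcd]
    have h1 : ContMDiffOn 𝓘(ℝ, ℝ) 𝓘(ℝ, E) ∞
        (e ∘ fun t => (chartAt E x).symm (z + t • w)) (Icc c d) :=
      (contMDiffOn_of_mem_maximalAtlas (I := 𝓘(ℝ, E)) (n := ∞)
        (IsManifold.subset_maximalAtlas he)).comp (hγ.mono (Icc_subset_Icc hc hd)) hm
    exact (contMDiffOn_iff_contDiffOn.1 h1).of_le (by simp)
  · refine (ae_restrict_iff' measurableSet_Icc).2 (Filter.Eventually.of_forall fun t ht => ?_)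
    obtain ⟨h1, h2⟩ := h t ht
    have hd : MDifferentiableAt 𝓘(ℝ, E) 𝓘(ℝ, E) (chartAt E x).symm (z + t • w) :=
      (contMDiffAt_symm_of_mem_maximalAtlas (I := 𝓘(ℝ, E)) (n := ∞)
        (IsManifold.chart_mem_maximalAtlas x) h1).mdifferentiableAt (by simp)
    have hσ : HasMFDerivAt 𝓘(ℝ, ℝ) 𝓘(ℝ, E) (fun t : ℝ => z + t • w) t
        ((ContinuousLinearMap.id ℝ ℝ).smulRight w) :=
      (((hasFDerivAt_id t).smul_const w).const_add z).hasMFDerivAt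
    have hc := hd.hasMFDerivAt.comp t hσ
    refine ⟨hc.mdifferentiableAt, ?_⟩
    have := hc.mfderiv
    change mfderiv 𝓘(ℝ, ℝ) 𝓘(ℝ, E) ((chartAt E x).symm ∘ fun t : ℝ => z + t • w) t (1 : ℝ) ∈
      C ((chartAt E x).symm (z + t • w))
    rw [this]
    have h6 : (((mfderiv 𝓘(ℝ, E) 𝓘(ℝ, E) (chartAt E x).symm (z + t • w)).comp
        ((ContinuousLinearMap.id ℝ ℝ).smulRight w)) (1 : ℝ) : E) =
        mfderiv 𝓘(ℝ, E) 𝓘(ℝ, E) (chartAt E x).symm (z + t • w) w := by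
      change mfderiv 𝓘(ℝ, E) 𝓘(ℝ, E) (chartAt E x).symm (z + t • w) ((1 : ℝ) • w) = _
      rw [one_smul]
    exact h6 ▸ h2

/-- In the chart at `x`, a timelike vector at `x` gives a vector `w₀` such that all vectors close
to `w₀` are future causal at all points close to `x`. -/
theorem exists_vector_eventually_mem_cone {x : M} (hx : (timelikeCone C x).Nonempty) :
    ∃ w₀ : E, ∀ᶠ y : E × E in 𝓝 (chartAt E x x, w₀), y.1 ∈ (chartAt E x).target ∧
      mfderiv 𝓘(ℝ, E) 𝓘(ℝ, E) (chartAt E x).symm y.1 y.2 ∈ C ((chartAt E x).symm y.1) := by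
  obtain ⟨v, hv⟩ := hx
  set e := chartAt E x with he
  have hxs : x ∈ e.source := mem_chart_source E x
  have hopen : e.target ∈ 𝓝 (e x) := e.open_target.mem_nhds (e.map_source hxs)
  have hcont : ContinuousOn (tangentMapWithin 𝓘(ℝ, E) 𝓘(ℝ, E) e.symm e.target)
      (Bundle.TotalSpace.proj ⁻¹' e.target) :=
    (contMDiffOn_chart_symm (I := 𝓘(ℝ, E)) (n := ∞) (x := x)).continuousOn_tangentMapWithin
      (by simp) e.open_target.uniqueMDiffOn
  have hleft : (mfderiv 𝓘(ℝ, E) 𝓘(ℝ, E) e.symm (e x)).comp (mfderiv 𝓘(ℝ, E) 𝓘(ℝ, E) e x) =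
      ContinuousLinearMap.id ℝ (TangentSpace 𝓘(ℝ, E) x) :=
    (mdifferentiable_chart x).symm_comp_deriv hxs
  set w₀ : E := mfderiv 𝓘(ℝ, E) 𝓘(ℝ, E) e x v with hw₀
  refine ⟨w₀, ?_⟩
  let Φ := (tangentBundleModelSpaceHomeomorph 𝓘(ℝ, E)).symm
  have hΦ : Filter.Tendsto (fun y : E × E => tangentMapWithin 𝓘(ℝ, E) 𝓘(ℝ, E) e.symm e.target
      (Φ y)) (𝓝 (e x, w₀)) (𝓝 (⟨x, v⟩ : TangentBundle 𝓘(ℝ, E) M)) := by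
    have h1 : ContinuousAt (tangentMapWithin 𝓘(ℝ, E) 𝓘(ℝ, E) e.symm e.target) (Φ (e x, w₀)) :=
      hcont.continuousAt ((FiberBundle.continuous_proj E _).continuousAt.preimage_mem_nhds hopen)
    have h2 : tangentMapWithin 𝓘(ℝ, E) 𝓘(ℝ, E) e.symm e.target (Φ (e x, w₀)) =
        (⟨x, v⟩ : TangentBundle 𝓘(ℝ, E) M) := by
      have h3 : (mfderivWithin 𝓘(ℝ, E) 𝓘(ℝ, E) e.symm e.target (e x) w₀ : E) = v := by
        rw [mfderivWithin_of_isOpen e.open_target (e.map_source hxs)]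
        exact congrArg (fun f => f v) hleft
      have key : ∀ (p q : M) (u : E), p = q →
          (⟨p, u⟩ : TangentBundle 𝓘(ℝ, E) M) = ⟨q, u⟩ := by
        rintro p q u rfl
        rfl
      change (⟨e.symm (e x), (mfderivWithin 𝓘(ℝ, E) 𝓘(ℝ, E) e.symm e.target (e x) w₀ : E)⟩ :
        TangentBundle 𝓘(ℝ, E) M) = _
      exact (key _ _ _ (e.left_inv hxs)).trans
        (congrArg (fun u : E => (⟨x, u⟩ : TangentBundle 𝓘(ℝ, E) M)) h3)
    rw [← h2]
    exact h1.comp Φ.continuous.continuousAt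
  have h1 := hΦ.eventually (isOpen_interior.mem_nhds hv)
  have h2 : ∀ᶠ y : E × E in 𝓝 (e x, w₀), y.1 ∈ e.target :=
    continuousAt_fst.eventually hopen
  filter_upwards [h1, h2] with y hy1 hy2
  refine ⟨hy2, ?_⟩
  have := interior_subset hy1
  have h3 : mfderivWithin 𝓘(ℝ, E) 𝓘(ℝ, E) e.symm e.target y.1 y.2 ∈ C (e.symm y.1) := this
  rwa [mfderivWithin_of_isOpen e.open_target hy2] at h3

/-- Every neighbourhood of `x` contains a point `r` that lies in the causal future of all points
close to `x`, including `x` itself. -/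
theorem exists_eventually_isFutureCausal {x : M} (hx : (timelikeCone C x).Nonempty)
    {U : Set M} (hU : U ∈ 𝓝 x) :
    ∃ r ∈ U, ∀ᶠ y in 𝓝 x, ∃ (γ : ℝ → M) (a b : ℝ), IsFutureCausal C γ a b ∧ γ a = y ∧ γ b = r := by
  obtain ⟨w₀, hw₀⟩ := exists_vector_eventually_mem_cone hx
  set e := chartAt E x with he
  have hxs : x ∈ e.source := mem_chart_source E x
  rw [nhds_prod_eq] at hw₀
  obtain ⟨P, hP, Q, hQ, hPQ⟩ := Filter.eventually_prod_iff.1 hw₀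
  have hW : {z | P z} ∩ e.symm ⁻¹' U ∈ 𝓝 (e x) :=
    Filter.inter_mem hP (e.symm.continuousAt (e.map_source hxs) (by simpa [hxs] using hU))
  obtain ⟨ρ, hρ, hball⟩ := Metric.mem_nhds_iff.1 hW
  have hline : Filter.Tendsto (fun s : ℝ => e x + s • w₀) (𝓝[>] 0) (𝓝 (e x)) := by
    have : Continuous (fun s : ℝ => e x + s • w₀) := by fun_prop
    simpa using (this.tendsto 0).mono_left nhdsWithin_le_nhds
  obtain ⟨s, hsb, hs⟩ :=
    ((hline.eventually (Metric.ball_mem_nhds _ hρ)).and self_mem_nhdsWithin).exists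
  have hs : 0 < s := hs
  refine ⟨e.symm (e x + s • w₀), (hball hsb).2, ?_⟩
  -- The segment from `e y` to `e x + s • w₀`, run in time `s`, has a velocity close to `w₀`.
  have hvel : Filter.Tendsto (fun y => s⁻¹ • (e x + s • w₀ - e y)) (𝓝 x) (𝓝 w₀) := by
    have h1 := ((e.continuousAt hxs).tendsto.const_sub (e x + s • w₀)).const_smul s⁻¹
    simpa [smul_smul, hs.ne'] using h1
  filter_upwards [hvel.eventually hQ, e.open_source.mem_nhds hxs,
    (e.continuousAt hxs).eventually (Metric.ball_mem_nhds _ hρ)] with y hy1 hys hyb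
  have hend : e y + s • s⁻¹ • (e x + s • w₀ - e y) = e x + s • w₀ := by
    rw [smul_inv_smul₀ hs.ne']
    abel
  refine ⟨_, 0, s, isFutureCausal_chart_symm_segment (x := x) (z := e y)
    (w := s⁻¹ • (e x + s • w₀ - e y)) hs fun t ht => ?_, ?_, ?_⟩
  · refine hPQ (hball ?_).1 hy1
    have := (convex_ball (e x) ρ).add_smul_sub_mem hyb hsb
      (t := t * s⁻¹) ⟨by have := ht.1; positivity, by
        rw [← div_eq_mul_inv]; exact div_le_one_of_le₀ ht.2 hs.le⟩
    rwa [smul_smul]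
  · simpa using e.left_inv hys
  · rw [hend]

/-- The null distance from `x` tends to `0` at `x`: points close to `x` are joined to `x` through a
common causal successor, at which `τ` is close to `τ x`. -/
theorem eventually_nullDist_lt (hτ : IsTimeFunction C τ) {x : M}
    (hx : (timelikeCone C x).Nonempty) {ε : ℝ} (hε : 0 < ε) :
    ∀ᶠ y in 𝓝 x, nullDist C τ x y < ENNReal.ofReal ε := by
  have hU : {y | |τ y - τ x| < ε / 4} ∈ 𝓝 x := by
    filter_upwards [Metric.tendsto_nhds.1 (hτ.1.continuousAt (x := x)) (ε / 4) (by positivity)]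
      with y hy
    simpa [Real.dist_eq] using hy
  obtain ⟨r, hr, hev⟩ := exists_eventually_isFutureCausal hx hU
  obtain ⟨γ, a, b, hγ, hγa, hγb⟩ := hev.self_of_nhds
  filter_upwards [hev, hU] with y ⟨γ', a', b', hγ', hγa', hγb'⟩ hy
  have h1 := hγ.nullDist_le (τ := τ)
  have h2 := hγ'.nullDist_le (τ := τ)
  rw [hγa, hγb] at h1
  rw [hγa', hγb'] at h2
  have hr : |τ r - τ x| < ε / 4 := hr
  have hy : |τ y - τ x| < ε / 4 := hy
  calc nullDist C τ x y ≤ nullDist C τ x r + nullDist C τ y r := by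
        rw [nullDist_comm y r]
        exact nullDist_triangle x r y
    _ ≤ ENNReal.ofReal |τ r - τ x| + ENNReal.ofReal |τ r - τ y| := add_le_add h1 h2
    _ = ENNReal.ofReal (|τ r - τ x| + |τ r - τ y|) :=
        (ENNReal.ofReal_add (abs_nonneg _) (abs_nonneg _)).symm
    _ < ENNReal.ofReal ε := by
        refine (ENNReal.ofReal_lt_ofReal_iff hε).2 ?_
        have := abs_sub_le (τ r) (τ x) (τ y)
        rw [abs_sub_comm (τ x)] at this
        linarith

end Local

section LowerBound

variable {E : Type*} [NormedAddCommGroup E] [NormedSpace ℝ E]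
  {M : Type*} [TopologicalSpace M] [ChartedSpace E M] [IsManifold 𝓘(ℝ, E) ∞ M]
  {C : (p : M) → Set (TangentSpace 𝓘(ℝ, E) p)} {τ : M → ℝ}
  {h : Bundle.ContMDiffRiemannianMetric 𝓘(ℝ, E) ∞ E (fun p : M => TangentSpace 𝓘(ℝ, E) p)}

/-! ### The Riemannian distance -/

theorem riemDist_self (p : M) : riemDist h p p = 0 := by
  let _ : Bundle.RiemannianBundle (fun p : M => TangentSpace 𝓘(ℝ, E) p) := ⟨h.toRiemannianMetric⟩
  exact Manifold.riemannianEDist_self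

theorem riemDist_comm (p q : M) : riemDist h p q = riemDist h q p := by
  let _ : Bundle.RiemannianBundle (fun p : M => TangentSpace 𝓘(ℝ, E) p) := ⟨h.toRiemannianMetric⟩
  exact Manifold.riemannianEDist_comm

theorem riemDist_triangle (p q r : M) : riemDist h p r ≤ riemDist h p q + riemDist h q r := by
  let _ : Bundle.RiemannianBundle (fun p : M => TangentSpace 𝓘(ℝ, E) p) := ⟨h.toRiemannianMetric⟩
  exact Manifold.riemannianEDist_triangle

theorem exists_setOf_riemDist_lt_subset [RegularSpace M] {p : M} {s : Set M} (hs : s ∈ 𝓝 p) :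
    ∃ c : ℝ, 0 < c ∧ {q | riemDist h p q < ENNReal.ofReal c} ⊆ s := by
  let _ : Bundle.RiemannianBundle (fun p : M => TangentSpace 𝓘(ℝ, E) p) := ⟨h.toRiemannianMetric⟩
  have : IsContinuousRiemannianBundle E (fun p : M => TangentSpace 𝓘(ℝ, E) p) :=
    ⟨h.inner, h.contMDiff.continuous, fun _ _ _ => rfl⟩
  obtain ⟨c, hc, hsub⟩ := setOfPred_riemannianEDist_lt_subset_nhds 𝓘(ℝ, E) hs
  refine ⟨c, hc, ?_⟩
  rw [ENNReal.ofReal_coe_nnreal]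
  exact hsub

/-! ### The lower bound for the null distance -/

theorem _root_.IsPreconnected.inter_frontier_nonempty {X : Type*} [TopologicalSpace X]
    {s B : Set X} (hs : IsPreconnected s) (hB : IsOpen B) (h : (s ∩ B).Nonempty)
    (h' : (s ∩ Bᶜ).Nonempty) : (s ∩ frontier B).Nonempty := by
  rw [hB.frontier_eq]
  by_contra hne
  rw [not_nonempty_iff_eq_empty] at hne
  have hmem : ∀ x ∈ s, x ∉ B → x ∈ (closure B)ᶜ := fun x hx hxB hxc =>
    notMem_empty x (hne ▸ ⟨hx, hxc, hxB⟩)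
  obtain ⟨y, hys, hyB⟩ := h'
  obtain ⟨x, -, hxB, hxc⟩ := hs B (closure B)ᶜ hB isClosed_closure.isOpen_compl
    (fun x hx => or_iff_not_imp_left.2 (hmem x hx)) h ⟨y, hys, hmem y hys hyB⟩
  exact hxc (subset_closure hxB)

/-- On a set where `τ` is anti-Lipschitz, a causal curve makes `τ` vary at least as much as the
Riemannian distance, whatever the orientation of the curve. -/
theorem riemDist_le_of_causal {U : Set M} {β : ℝ → M} {a b s t : ℝ}
    (hU : ∀ p ∈ U, ∀ q ∈ U, CausalRel C p q → riemDist h p q ≤ ENNReal.ofReal (τ q - τ p))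
    (hβ : IsFutureCausal C β a b ∨ IsPastCausal C β a b) (has : a ≤ s) (hst : s ≤ t) (htb : t ≤ b)
    (hs : β s ∈ U) (ht : β t ∈ U) :
    riemDist h (β s) (β t) ≤ ENNReal.ofReal |τ (β t) - τ (β s)| := by
  rcases hβ with hβ | hβ
  · exact (hU _ hs _ ht (hβ.causalRel has hst htb)).trans
      (ENNReal.ofReal_le_ofReal (le_abs_self _))
  · rw [riemDist_comm, abs_sub_comm]
    exact (hU _ ht _ hs (hβ.causalRel has hst htb)).trans
      (ENNReal.ofReal_le_ofReal (le_abs_self _))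

/-- Let `B` be an open set whose closure lies in a set where `τ` is anti-Lipschitz. A piecewise
causal path starting at `p ∈ B` has null length at least the Riemannian distance from `p` to its
endpoint as long as its break points stay in `B`; once one of them leaves `B`, the null length is
at least the radius `c` of any Riemannian ball around `p` contained in `B`. -/
theorem riemDist_le_nullLength_or (hτ : IsTimeFunction C τ) {U B : Set M} {c : ℝ}
    (hU : ∀ p ∈ U, ∀ q ∈ U, CausalRel C p q → riemDist h p q ≤ ENNReal.ofReal (τ q - τ p))
    (hB : IsOpen B) (hBU : closure B ⊆ U) {p : M} (hp : p ∈ B)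
    (hc : {q | riemDist h p q < ENNReal.ofReal c} ⊆ B)
    {β : ℝ → M} {a : ℕ → ℝ} (hβ0 : β (a 0) = p) (k : ℕ)
    (hβ : ∀ i < k, IsFutureCausal C β (a i) (a (i + 1)) ∨ IsPastCausal C β (a i) (a (i + 1))) :
    (β (a k) ∈ B ∧ riemDist h p (β (a k)) ≤ ENNReal.ofReal (nullLength τ β k a)) ∨
      ENNReal.ofReal c ≤ ENNReal.ofReal (nullLength τ β k a) := by
  induction k with
  | zero => exact Or.inl ⟨hβ0 ▸ hp, by simp [hβ0, riemDist_self]⟩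
  | succ k ih =>
    have hk := hβ k k.lt_succ_self
    have hlt : a k < a (k + 1) := hk.elim (fun h => h.1) fun h => h.1
    have hL : nullLength τ β (k + 1) a = nullLength τ β k a + |τ (β (a (k + 1))) - τ (β (a k))| :=
      Finset.sum_range_succ _ _
    rcases ih fun i hi => hβ i (hi.trans k.lt_succ_self) with ⟨hkB, hkd⟩ | hkc
    · have hkU := hBU (subset_closure hkB)
      -- The null length of the path up to a point of the last piece that lies in `U`.
      have hmain : ∀ t ∈ Icc (a k) (a (k + 1)), β t ∈ U →
          riemDist h p (β t) ≤ ENNReal.ofReal (nullLength τ β (k + 1) a) := fun t ht htU => by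
        rw [hL, ENNReal.ofReal_add (nullLength_nonneg ..) (abs_nonneg _)]
        refine (riemDist_triangle p (β (a k)) (β t)).trans (add_le_add hkd ?_)
        exact (riemDist_le_of_causal hU hk le_rfl ht.1 ht.2 hkU htU).trans
          (ENNReal.ofReal_le_ofReal (hτ.abs_sub_le_of_causal hk ht))
      by_cases hB' : β (a (k + 1)) ∈ B
      · exact Or.inl ⟨hB', hmain _ (right_mem_Icc.2 hlt.le) (hBU (subset_closure hB'))⟩
      · -- The last piece leaves `B`, so it meets the frontier of `B`, which lies in `U \ B`.
        have hcont : ContinuousOn β (Icc (a k) (a (k + 1))) := hk.elim (fun h => h.2.1.1)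
          fun h => h.2.1.1
        obtain ⟨_, ⟨t, ht, rfl⟩, htB⟩ := (isPreconnected_Icc.image β hcont).inter_frontier_nonempty
          hB ⟨_, ⟨_, left_mem_Icc.2 hlt.le, rfl⟩, hkB⟩
          ⟨_, ⟨_, right_mem_Icc.2 hlt.le, rfl⟩, hB'⟩
        rw [hB.frontier_eq] at htB
        exact Or.inr ((not_lt.1 fun hlt' => htB.2 (hc hlt')).trans (hmain t ht (hBU htB.1)))
    · refine Or.inr (hkc.trans (ENNReal.ofReal_le_ofReal ?_))
      rw [hL]
      exact le_add_of_nonneg_right (abs_nonneg _)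

/-- Outside a neighbourhood of `p`, the null distance from `p` is bounded away from `0`. -/
theorem exists_le_nullDist [RegularSpace M] (hτ : IsTimeFunction C τ)
    (hanti : IsLocallyAntiLipschitz C τ) {p : M} {V : Set M} (hV : V ∈ 𝓝 p) :
    ∃ c : ℝ, 0 < c ∧ ∀ q ∉ V, ENNReal.ofReal c ≤ nullDist C τ p q := by
  obtain ⟨U, hU, h, hUh⟩ := hanti p
  obtain ⟨F, hF, hFcl, hFsub⟩ := exists_mem_nhds_isClosed_subset (Filter.inter_mem hU hV)
  have hBF : closure (interior F) ⊆ F := hFcl.closure_subset_iff.2 interior_subset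
  obtain ⟨c, hc0, hc⟩ := exists_setOf_riemDist_lt_subset (h := h) (interior_mem_nhds.2 hF)
  refine ⟨c, hc0, fun q hq => ?_⟩
  refine le_iInf fun β => le_iInf fun k => le_iInf fun a => le_iInf fun hβ => le_iInf fun hp =>
    le_iInf fun hβq => ?_
  refine (riemDist_le_nullLength_or hτ hUh isOpen_interior
    (hBF.trans (hFsub.trans inter_subset_left)) (mem_interior_iff_mem_nhds.2 hF) hc hp k
    hβ.2).resolve_left fun hk => hq ?_
  rw [← hβq]
  exact (hFsub (interior_subset hk.1)).2

end LowerBound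

/-! ### The null distance as a metric -/

section Metric

variable {E : Type*} [NormedAddCommGroup E] [NormedSpace ℝ E]
  {M : Type*} [TopologicalSpace M] [ChartedSpace E M] [IsManifold 𝓘(ℝ, E) ∞ M]
  {C : (p : M) → Set (TangentSpace 𝓘(ℝ, E) p)} {τ : M → ℝ}

theorem nullDist_self (hτ : IsTimeFunction C τ) {p : M} (hp : (timelikeCone C p).Nonempty) :
    nullDist C τ p p = 0 := by
  refine nonpos_iff_eq_zero.1 (ENNReal.le_of_forall_pos_le_add fun ε hε _ => ?_)
  have := (eventually_nullDist_lt hτ hp (ε := ε) hε).self_of_nhds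
  simpa using this.le

/-- The points at finite null distance from `p` form a clopen set. -/
theorem nullDist_ne_top [PreconnectedSpace M] (hτ : IsTimeFunction C τ)
    (hC : ∀ p : M, (timelikeCone C p).Nonempty) (p q : M) : nullDist C τ p q ≠ ⊤ := by
  have hev : ∀ x : M, ∀ᶠ y in 𝓝 x, nullDist C τ x y < ⊤ := fun x =>
    (eventually_nullDist_lt hτ (hC x) one_pos).mono fun y hy => hy.trans ENNReal.ofReal_lt_top
  have hclopen : IsClopen {q | nullDist C τ p q < ⊤} := by
    refine ⟨⟨isOpen_iff_mem_nhds.2 fun x hx => ?_⟩, isOpen_iff_mem_nhds.2 fun x hx => ?_⟩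
    · filter_upwards [hev x] with y hy hpy
      refine hx ((nullDist_triangle p y x).trans_lt (ENNReal.add_lt_top.2 ⟨hpy, ?_⟩))
      rwa [nullDist_comm]
    · filter_upwards [hev x] with y hy
      exact (nullDist_triangle p x y).trans_lt (ENNReal.add_lt_top.2 ⟨hx, hy⟩)
  have huniv := hclopen.eq_univ ⟨p, by simp [nullDist_self hτ (hC p)]⟩
  have hq : q ∈ {q | nullDist C τ p q < ⊤} := huniv ▸ mem_univ q
  exact ne_of_lt hq

end Metric

end ConeGeometry

open ConeGeometry

theorem mainTheorem6 {E : Type*} [NormedAddCommGroup E] [NormedSpace ℝ E] [FiniteDimensional ℝ E]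
    {M : Type*} [tM : TopologicalSpace M] [T2Space M] [ParacompactSpace M] [ConnectedSpace M]
    [ChartedSpace E M] [IsManifold 𝓘(ℝ, E) ∞ M]
    (C : (p : M) → Set (TangentSpace 𝓘(ℝ, E) p)) (hC : ConeGeometry.IsProperConeStructure C)
    (τ : M → ℝ) (hτ : ConeGeometry.IsTimeFunction C τ)
    (hanti : ConeGeometry.IsLocallyAntiLipschitz C τ) :
    ∃ m : MetricSpace M,
      (∀ p q : M, ConeGeometry.nullDist C τ p q = ENNReal.ofReal (m.dist p q)) ∧
      m.toPseudoMetricSpace.toUniformSpace.toTopologicalSpace = tM := by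
  have hfin := nullDist_ne_top hτ hC.2
  let m : MetricSpace M :=
    { dist := fun p q => (nullDist C τ p q).toReal
      dist_self := fun p => by simp [nullDist_self hτ (hC.2 p)]
      dist_comm := fun p q => by simp only [nullDist_comm p q]
      dist_triangle := fun p q r => by
        rw [← ENNReal.toReal_add (hfin p q) (hfin q r)]
        exact ENNReal.toReal_mono (ENNReal.add_ne_top.2 ⟨hfin p q, hfin q r⟩)
          (nullDist_triangle p q r)
      eq_of_dist_eq_zero := fun {p q} hpq => by
        by_contra hne
        obtain ⟨c, hc, hle⟩ := exists_le_nullDist hτ hanti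
          (isOpen_compl_singleton.mem_nhds (show p ∈ ({q}ᶜ : Set M) from hne))
        have h0 : nullDist C τ p q = 0 :=
          ((ENNReal.toReal_eq_zero_iff _).1 hpq).resolve_right (hfin p q)
        have := hle q (by simp)
        rw [h0, nonpos_iff_eq_zero, ENNReal.ofReal_eq_zero] at this
        exact this.not_gt hc }
  refine ⟨m, fun p q => (ENNReal.ofReal_toReal (hfin p q)).symm, ?_⟩
  refine TopologicalSpace.ext_nhds fun p => ?_
  have hb := @Metric.nhds_basis_ball M m.toPseudoMetricSpace p
  have hdist : ∀ q, m.dist q p = (nullDist C τ p q).toReal := fun q => by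
    rw [nullDist_comm]
    rfl
  refine le_antisymm (fun V hV => ?_) (hb.ge_iff.2 fun ε hε => ?_)
  · obtain ⟨c, hc, hle⟩ := exists_le_nullDist hτ hanti hV
    refine hb.mem_iff.2 ⟨c, hc, fun q hq => ?_⟩
    by_contra hqV
    have hq : m.dist q p < c := hq
    rw [hdist] at hq
    exact hq.not_ge ((ENNReal.ofReal_le_iff_le_toReal (hfin p q)).1 (hle q hqV))
  · filter_upwards [eventually_nullDist_lt hτ (hC.2 p) hε] with q hq
    change m.dist q p < ε
    rw [hdist]
    exact (ENNReal.lt_ofReal_iff_toReal_lt (hfin p q)).1 hq
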